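/- Let $K \subseteq \mathbb{R}^2$ be a convex set which is a universal cover for arcs of unit length, that is, for every planar arc $A$ of length one (the image of a continuous injective map $\gamma : [0,1] \to \mathbb{R}^2$ of length $1$), $K$ contains the image of $A$ under some isometry of the plane (reflections allowed). Then the area of $K$ is at least $0.227498$. -/

import Mathlib

open MeasureTheory Set

/-- The Euclidean plane. -/
abbrev Plane : Type := EuclideanSpace ℝ (Fin 2)

/-- `A` is a planar arc of unit length: the image of the compact interval `[0, 1]` under a
continuous injective map whose length (the supremum of the lengths of inscribed polygons)
is exactly one. -/
def IsUnitArc (A : Set Plane) : Prop :=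
  ∃ γ : ℝ → Plane, ContinuousOn γ (Icc 0 1) ∧ InjOn γ (Icc 0 1) ∧
    eVariationOn γ (Icc 0 1) = 1 ∧ γ '' Icc 0 1 = A

/-- `K` contains a congruent copy of `A`, that is, the image of `A` under some isometry of the
plane onto itself (translations, rotations, reflections and their composites). -/
def ContainsCongruentCopy (K A : Set Plane) : Prop :=
  ∃ e : Plane ≃ᵢ Plane, e '' A ⊆ K

/-- `K` is a universal cover for arcs of unit length. -/
def IsUnitArcCover (K : Set Plane) : Prop :=
  ∀ A : Set Plane, IsUnitArc A → ContainsCongruentCopy K A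

/-!
Let `K` be a convex cover. Besides a unit segment, `K` contains two further hulls of unit arcs: an
equilateral triangle of side `1/2` (hull of two of its sides) and a rectangle `2/5 × 3/10` (hull of
three of its sides, since `3/10 + 2/5 + 3/10 = 1`). After applying an isometry to `K`, the
rectangle is `[0, 2/5] × [0, 3/10]`. Two area estimates carry the proof; both are instances of
`area K ≥ V(P, Q)` for `P, Q ⊆ K`, where `V` is the mixed area.

* `volume_convex_ge_cross`: if `A, B, C, D ∈ K`, then `area K ≥ |(D - C) × (B - A)| / 2`.
* `volume_ge_of_rectangle`: if `K` contains `[0, a] × [0, b]` and points realizing a horizontal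
  extent `W` and a vertical extent `H`, then `area K ≥ (b W + a H) / 2`. Indeed the rectangle and
  the four triangles that its sides span with the extreme points of the four axis directions do not
  overlap, and the areas add up to exactly the right-hand side.

Suppose that `area K < 0.227498`. The first estimate, applied to the unit segment and the sides of
the triangle, forces some side of the triangle to be within `6°` of the direction of the
segment (`exists_small_of_hexagon`). Another side then makes an angle of about `60°` with the
segment, so that when the segment makes a small angle with the long side of the rectangle, the
triangle has a large vertical extent. With `c` and `s` the absolute values of the cosine and sine
of the angle between the segment and the long side, either `3/10 c + 2/5 s ≥ 0.455`, or `s` is so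
close to `1` that `W ≥ 2/5` and `H ≥ s` suffice, or `s` is below `0.48` and the vertical extent of
the triangle suffices (`extents_ge_of_near`). In each case `3/10 W + 2/5 H ≥ 0.455`, and the second
estimate gives `area K ≥ 0.2275`.
-/

/-! ### Areas of triangles -/

/-- The cross product of two plane vectors. -/
def cross (u v : Plane) : ℝ := u 0 * v 1 - u 1 * v 0

/-- The open triangle with vertices `(0, 0)`, `(1, 0)`, `(0, 1)`. -/
def stdTriangle : Set Plane := {z | 0 < z 0 ∧ 0 < z 1 ∧ z 0 + z 1 < 1}

/-- The points `A + s (B - A) + t (C - A)` with `s, t > 0` and `s + t < 1`: the open triangle `A B C`.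
For collinear `A, B, C` it degenerates to a null set; no nondegeneracy is
required. -/
def openTriangle (A B C : Plane) : Set Plane :=
  {z | ∃ s t : ℝ, 0 < s ∧ 0 < t ∧ s + t < 1 ∧ z = A + (s • (B - A) + t • (C - A))}

/-- The area of a plane set may be computed in `ℝ × ℝ`; no measurability is needed. -/
theorem volume_plane_eq (s : Set (ℝ × ℝ)) :
    volume {z : Plane | (z 0, z 1) ∈ s} = volume s := by
  have h := (volume_preserving_finTwoArrow ℝ).comp (PiLp.volume_preserving_ofLp (Fin 2))
  have h2 := MeasurePreserving.measure_preimage_equiv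
    (f := (MeasurableEquiv.toLp 2 (Fin 2 → ℝ)).symm.trans MeasurableEquiv.finTwoArrow) h s
  exact h2

theorem volume_stdTriangle : volume stdTriangle = ENNReal.ofReal (1 / 2) := by
  have h := volume_plane_eq (regionBetween (fun _ : ℝ => (0 : ℝ)) (fun x => 1 - x) (Ioo 0 1))
  rw [show (volume : Measure (ℝ × ℝ)) = volume.prod volume from rfl,
    volume_regionBetween_eq_integral] at h
  · rw [← integral_Ioc_eq_integral_Ioo, ← intervalIntegral.integral_of_le zero_le_one] at h
    simp only [Pi.sub_apply, sub_zero] at h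
    rw [show (1 / 2 : ℝ) = ∫ x in (0 : ℝ)..1, (1 - x) by
      rw [intervalIntegral.integral_sub] <;> norm_num, ← h]
    congr 1
    ext z
    simp only [stdTriangle, regionBetween, mem_ofPred_eq, mem_Ioo]
    constructor
    · rintro ⟨h0, h1, h2⟩
      exact ⟨⟨h0, by linarith⟩, h1, by linarith⟩
    · rintro ⟨⟨h0, -⟩, h1, h2⟩
      exact ⟨h0, h1, by linarith⟩
  · exact (continuous_const.integrableOn_Icc (a := 0) (b := 1)).mono_set Ioo_subset_Icc_self
  · exact ((by fun_prop : Continuous fun x : ℝ => 1 - x).integrableOn_Icc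
      (a := 0) (b := 1)).mono_set Ioo_subset_Icc_self
  · exact measurableSet_Ioo
  · intro x hx
    linarith [hx.2]

theorem volume_openTriangle (A B C : Plane) :
    volume (openTriangle A B C) = ENNReal.ofReal (|cross (B - A) (C - A)| / 2) := by
  set M : Matrix (Fin 2) (Fin 2) ℝ := !![(B - A) 0, (C - A) 0; (B - A) 1, (C - A) 1] with hM
  set b := (EuclideanSpace.basisFun (Fin 2) ℝ).toBasis
  have hL : ∀ z : Plane, Matrix.toLin b b M z = z 0 • (B - A) + z 1 • (C - A) := by
    intro z
    conv_lhs => rw [← b.sum_repr z]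
    rw [map_sum, Fin.sum_univ_two, map_smul, map_smul, Matrix.toLin_self, Matrix.toLin_self]
    ext i
    fin_cases i <;> simp [b, M, Fin.sum_univ_two]
  have himg : openTriangle A B C = (fun z => A + z) '' (Matrix.toLin b b M '' stdTriangle) := by
    ext z
    simp only [openTriangle, mem_ofPred_eq, mem_image, stdTriangle, exists_exists_and_eq_and, hL]
    constructor
    · rintro ⟨s, t, hs, ht, hst, rfl⟩
      exact ⟨!₂[s, t], by simpa using ⟨hs, ht, hst⟩, by simp⟩
    · rintro ⟨w, ⟨h0, h1, h2⟩, rfl⟩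
      exact ⟨w 0, w 1, h0, h1, h2, rfl⟩
  rw [himg, image_add_left, measure_preimage_add, Measure.addHaar_image_linearMap,
    LinearMap.det_toLin, volume_stdTriangle, ← ENNReal.ofReal_mul (abs_nonneg _)]
  congr 1
  rw [hM, Matrix.det_fin_two_of, cross]
  ring_nf

theorem convex_openTriangle (A B C : Plane) : Convex ℝ (openTriangle A B C) := by
  rintro _ ⟨s, t, hs, ht, hst, rfl⟩ _ ⟨s', t', hs', ht', hst', rfl⟩ p q hp hq hpq
  refine ⟨p * s + q * s', p * t + q * t', ?_, ?_, ?_, ?_⟩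
  · rcases hp.eq_or_lt with rfl | hp
    · simp_all
    · nlinarith [mul_pos hp hs, mul_nonneg hq hs'.le]
  · rcases hp.eq_or_lt with rfl | hp
    · simp_all
    · nlinarith [mul_pos hp ht, mul_nonneg hq ht'.le]
  · rcases hp.eq_or_lt with rfl | hp
    · simp_all
    · nlinarith [mul_pos hp (sub_pos.2 hst), mul_nonneg hq (sub_pos.2 hst').le]
  · obtain rfl : p = 1 - q := by linarith
    module

theorem openTriangle_subset {K : Set Plane} (hK : Convex ℝ K) {A B C : Plane} (hA : A ∈ K)
    (hB : B ∈ K) (hC : C ∈ K) : openTriangle A B C ⊆ K := by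
  rintro _ ⟨s, t, hs, ht, hst, rfl⟩
  have h := hK.sum_mem (t := Finset.univ) (w := ![1 - s - t, s, t]) (z := ![A, B, C])
    (by intro i _; fin_cases i <;> simp <;> linarith) (by simp [Fin.sum_univ_three]; ring)
    (by intro i _; fin_cases i <;> simpa)
  simp only [Fin.sum_univ_three] at h
  convert h using 1
  simp
  module

/-- The hull of two segments has at least half the area of the parallelogram they span. If `A` and
`B` lie on opposite sides of the line `C D`, the triangles `C D A` and `C D B` are disjoint and their
areas add up; if not, the larger of the two triangles is enough. -/
theorem volume_convex_ge_cross {K : Set Plane} (hK : Convex ℝ K) {A B C D : Plane} (hA : A ∈ K)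
    (hB : B ∈ K) (hC : C ∈ K) (hD : D ∈ K) :
    ENNReal.ofReal (|cross (D - C) (B - A)| / 2) ≤ volume K := by
  wlog h : cross (D - C) (A - C) ≤ cross (D - C) (B - C) generalizing A B
  · have := this hB hA (le_of_not_ge h)
    rwa [show cross (D - C) (B - A) = -cross (D - C) (A - B) by simp [cross]; ring, abs_neg]
  have hdiff : cross (D - C) (B - A) = cross (D - C) (B - C) - cross (D - C) (A - C) := by
    simp [cross]; ring
  rw [hdiff, abs_of_nonneg (sub_nonneg.2 h)]
  rcases le_or_gt 0 (cross (D - C) (A - C)) with hA0 | hA0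
  · refine le_trans ?_ (measure_mono (openTriangle_subset hK hC hD hB))
    rw [volume_openTriangle]
    exact ENNReal.ofReal_le_ofReal (by linarith [le_abs_self (cross (D - C) (B - C))])
  rcases le_or_gt (cross (D - C) (B - C)) 0 with hB0 | hB0
  · refine le_trans ?_ (measure_mono (openTriangle_subset hK hC hD hA))
    rw [volume_openTriangle]
    exact ENNReal.ofReal_le_ofReal (by linarith [neg_abs_le (cross (D - C) (A - C))])
  -- The triangle `C D P` lies on the same side of the line `C D` as `P`.
  have key : ∀ P : Plane, ∀ z ∈ openTriangle C D P,
      ∃ t : ℝ, 0 < t ∧ cross (D - C) (z - C) = t * cross (D - C) (P - C) := by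
    rintro P _ ⟨s, t, hs, ht, hst, rfl⟩
    exact ⟨t, ht, by simp [cross]; ring⟩
  have hdisj : Disjoint (openTriangle C D A) (openTriangle C D B) := by
    rw [Set.disjoint_left]
    intro z hz hz'
    obtain ⟨t, ht, h1⟩ := key A z hz
    obtain ⟨t', ht', h2⟩ := key B z hz'
    nlinarith [mul_pos ht (neg_pos.2 hA0), mul_pos ht' hB0]
  calc _ = volume (openTriangle C D A ∪ openTriangle C D B) := by
        rw [measure_union₀ ((convex_openTriangle C D B).nullMeasurableSet _) hdisj.aedisjoint,
          volume_openTriangle, volume_openTriangle, ← ENNReal.ofReal_add (by positivity)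
          (by positivity), abs_of_neg hA0, abs_of_pos hB0]
        ring_nf
    _ ≤ volume K := measure_mono (union_subset (openTriangle_subset hK hC hD hA)
        (openTriangle_subset hK hC hD hB))

/-! ### Convex sets containing a rectangle -/

/-- The reason why triangles erected outwards on two sides of a convex polygon are disjoint. Let `p, q'`
be the outward heights of the apex of the first triangle above the two side lines, and `q, p'` those
of the apex of the second, each apex being extreme for its own side. A common point would have
height `t * p` above the first line, less than `t' * q`, and height `t' * p'` above the second, less
than `t * q'`. -/
theorem not_both_lt {t t' p q p' q' : ℝ} (hp : 0 ≤ p) (hp' : 0 ≤ p') (ht : 0 < t) (ht' : 0 < t')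
    (hqp : q ≤ p) (hqp' : q' ≤ p') (h : t * p < t' * q) (h' : t' * p' < t * q') : False := by
  have h1 : t < t' := lt_of_mul_lt_mul_right (h.trans_le (mul_le_mul_of_nonneg_left hqp ht'.le)) hp
  have h2 : t' < t :=
    lt_of_mul_lt_mul_right (h'.trans_le (mul_le_mul_of_nonneg_left hqp' ht.le)) hp'
  exact lt_asymm h1 h2

theorem volume_openRectangle {a b : ℝ} (ha : 0 ≤ a) :
    volume {z : Plane | (z 0, z 1) ∈ Ioo 0 a ×ˢ Ioo 0 b} = ENNReal.ofReal (a * b) := by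
  rw [volume_plane_eq, Measure.volume_eq_prod, Measure.prod_prod, Real.volume_Ioo, Real.volume_Ioo,
    sub_zero, sub_zero, ENNReal.ofReal_mul ha]

/-- The rectangle `[0, a] × [0, b]` together with points `L`, `R`, `D`, `T` of `K`, extreme to the
left, right, bottom and top among themselves and the rectangle: the open rectangle and the open
triangles on its sides with these apexes are pairwise disjoint, and their areas add up to the bound. -/
theorem volume_ge_of_extreme {K : Set Plane} (hK : Convex ℝ K) {a b : ℝ} (ha : 0 < a) (hb : 0 < b)
    (h00 : !₂[0, 0] ∈ K) (ha0 : !₂[a, 0] ∈ K) (hab : !₂[a, b] ∈ K) (h0b : !₂[0, b] ∈ K)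
    {L R D T : Plane} (hL : L ∈ K) (hR : R ∈ K) (hD : D ∈ K) (hT : T ∈ K)
    (hRa : a ≤ R 0) (hRD : D 0 ≤ R 0) (hRT : T 0 ≤ R 0)
    (hL0 : L 0 ≤ 0) (hLD : L 0 ≤ D 0) (hLT : L 0 ≤ T 0)
    (hTb : b ≤ T 1) (hTL : L 1 ≤ T 1) (hTR : R 1 ≤ T 1)
    (hD0 : D 1 ≤ 0) (hDL : D 1 ≤ L 1) (hDR : D 1 ≤ R 1) :
    ENNReal.ofReal ((b * (R 0 - L 0) + a * (T 1 - D 1)) / 2) ≤ volume K := by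
  set Q : Set Plane := {z : Plane | (z 0, z 1) ∈ Ioo 0 a ×ˢ Ioo 0 b} with hQ
  set SR := openTriangle !₂[a, 0] !₂[a, b] R with hSR
  set ST := openTriangle !₂[0, b] !₂[a, b] T with hST
  set SL := openTriangle !₂[0, 0] !₂[0, b] L with hSL
  set SD := openTriangle !₂[0, 0] !₂[a, 0] D with hSD
  have mQ : ∀ z ∈ Q, (0 < z 0 ∧ z 0 < a) ∧ 0 < z 1 ∧ z 1 < b := fun z hz => hz
  -- Each triangle, described by the exact height `t * h` above its side of the rectangle and by strict
  -- bounds for the other coordinate, which come from the side being between its two neighbours.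
  have mR : ∀ z ∈ SR, ∃ t : ℝ, 0 < t ∧ z 0 = a + t * (R 0 - a) ∧ t * R 1 < z 1 ∧
      z 1 - b < t * (R 1 - b) := by
    rintro _ ⟨s, t, hs, ht, hst, rfl⟩
    have := mul_pos hs hb
    have := mul_pos (sub_pos.2 hst) hb
    refine ⟨t, ht, ?_, ?_, ?_⟩ <;> simp <;> linarith
  have mL : ∀ z ∈ SL, ∃ t : ℝ, 0 < t ∧ z 0 = t * L 0 ∧ t * L 1 < z 1 ∧
      z 1 - b < t * (L 1 - b) := by
    rintro _ ⟨s, t, hs, ht, hst, rfl⟩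
    have := mul_pos hs hb
    have := mul_pos (sub_pos.2 hst) hb
    refine ⟨t, ht, ?_, ?_, ?_⟩ <;> simp <;> linarith
  have mT : ∀ z ∈ ST, ∃ t : ℝ, 0 < t ∧ z 1 = b + t * (T 1 - b) ∧ t * T 0 < z 0 ∧
      z 0 - a < t * (T 0 - a) := by
    rintro _ ⟨s, t, hs, ht, hst, rfl⟩
    have := mul_pos hs ha
    have := mul_pos (sub_pos.2 hst) ha
    refine ⟨t, ht, ?_, ?_, ?_⟩ <;> simp <;> linarith
  have mD : ∀ z ∈ SD, ∃ t : ℝ, 0 < t ∧ z 1 = t * D 1 ∧ t * D 0 < z 0 ∧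
      z 0 - a < t * (D 0 - a) := by
    rintro _ ⟨s, t, hs, ht, hst, rfl⟩
    have := mul_pos hs ha
    have := mul_pos (sub_pos.2 hst) ha
    refine ⟨t, ht, ?_, ?_, ?_⟩ <;> simp <;> linarith
  have dQR : Disjoint Q SR := Set.disjoint_left.2 fun z hz hz' => by
    obtain ⟨t, ht, h0, -, -⟩ := mR z hz'
    linarith [mQ z hz, mul_nonneg ht.le (sub_nonneg.2 hRa)]
  have dQT : Disjoint Q ST := Set.disjoint_left.2 fun z hz hz' => by
    obtain ⟨t, ht, h0, -, -⟩ := mT z hz'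
    linarith [mQ z hz, mul_nonneg ht.le (sub_nonneg.2 hTb)]
  have dQL : Disjoint Q SL := Set.disjoint_left.2 fun z hz hz' => by
    obtain ⟨t, ht, h0, -, -⟩ := mL z hz'
    linarith [mQ z hz, mul_nonneg ht.le (neg_nonneg.2 hL0)]
  have dQD : Disjoint Q SD := Set.disjoint_left.2 fun z hz hz' => by
    obtain ⟨t, ht, h0, -, -⟩ := mD z hz'
    linarith [mQ z hz, mul_nonneg ht.le (neg_nonneg.2 hD0)]
  have dRL : Disjoint SR SL := Set.disjoint_left.2 fun z hz hz' => by
    obtain ⟨t, ht, h0, -, -⟩ := mR z hz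
    obtain ⟨t', ht', h0', -, -⟩ := mL z hz'
    linarith [mul_nonneg ht.le (sub_nonneg.2 hRa), mul_nonneg ht'.le (neg_nonneg.2 hL0)]
  have dTD : Disjoint ST SD := Set.disjoint_left.2 fun z hz hz' => by
    obtain ⟨t, ht, h0, -, -⟩ := mT z hz
    obtain ⟨t', ht', h0', -, -⟩ := mD z hz'
    linarith [mul_nonneg ht.le (sub_nonneg.2 hTb), mul_nonneg ht'.le (neg_nonneg.2 hD0)]
  have dRT : Disjoint SR ST := Set.disjoint_left.2 fun z hz hz' => by
    obtain ⟨t, ht, h0, h1, h2⟩ := mR z hz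
    obtain ⟨t', ht', h0', h1', h2'⟩ := mT z hz'
    exact not_both_lt (p := R 0 - a) (q := T 0 - a) (p' := T 1 - b) (q' := R 1 - b)
      (by linarith) (by linarith) ht ht' (by linarith) (by linarith) (by linarith) (by linarith)
  have dRD : Disjoint SR SD := Set.disjoint_left.2 fun z hz hz' => by
    obtain ⟨t, ht, h0, h1, h2⟩ := mR z hz
    obtain ⟨t', ht', h0', h1', h2'⟩ := mD z hz'
    exact not_both_lt (p := R 0 - a) (q := D 0 - a) (p' := -D 1) (q' := -R 1)
      (by linarith) (by linarith) ht ht' (by linarith) (by linarith) (by linarith) (by linarith)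
  have dTL : Disjoint ST SL := Set.disjoint_left.2 fun z hz hz' => by
    obtain ⟨t, ht, h0, h1, h2⟩ := mT z hz
    obtain ⟨t', ht', h0', h1', h2'⟩ := mL z hz'
    exact not_both_lt (p := T 1 - b) (q := L 1 - b) (p' := -L 0) (q' := -T 0)
      (by linarith) (by linarith) ht ht' (by linarith) (by linarith) (by linarith) (by linarith)
  have dLD : Disjoint SL SD := Set.disjoint_left.2 fun z hz hz' => by
    obtain ⟨t, ht, h0, h1, h2⟩ := mL z hz
    obtain ⟨t', ht', h0', h1', h2'⟩ := mD z hz'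
    exact not_both_lt (p := -L 0) (q := -D 0) (p' := -D 1) (q' := -L 1)
      (by linarith) (by linarith) ht ht' (by linarith) (by linarith) (by linarith) (by linarith)
  have nm : ∀ A B C : Plane, NullMeasurableSet (openTriangle A B C) volume := fun A B C =>
    (convex_openTriangle A B C).nullMeasurableSet _
  have vR : volume SR = ENNReal.ofReal (b * (R 0 - a) / 2) := by
    rw [hSR, volume_openTriangle, ← abs_neg, abs_of_nonneg] <;> simp [cross]
    nlinarith
  have vT : volume ST = ENNReal.ofReal (a * (T 1 - b) / 2) := by
    rw [hST, volume_openTriangle, abs_of_nonneg] <;> simp [cross]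
    nlinarith
  have vL : volume SL = ENNReal.ofReal (b * -L 0 / 2) := by
    rw [hSL, volume_openTriangle, abs_of_nonneg] <;> simp [cross]
    nlinarith
  have vD : volume SD = ENNReal.ofReal (a * -D 1 / 2) := by
    rw [hSD, volume_openTriangle, ← abs_neg, abs_of_nonneg] <;> simp [cross]
    nlinarith
  have pR : 0 ≤ b * (R 0 - a) / 2 := by have := mul_nonneg hb.le (sub_nonneg.2 hRa); linarith
  have pT : 0 ≤ a * (T 1 - b) / 2 := by have := mul_nonneg ha.le (sub_nonneg.2 hTb); linarith
  have pL : 0 ≤ b * -L 0 / 2 := by have := mul_nonneg hb.le (neg_nonneg.2 hL0); linarith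
  have pD : 0 ≤ a * -D 1 / 2 := by have := mul_nonneg ha.le (neg_nonneg.2 hD0); linarith
  have sQ : Q ⊆ K := by
    intro z hz
    obtain ⟨⟨x0, x1⟩, y0, y1⟩ := mQ z hz
    have e0 : !₂[z 0, 0] ∈ K := by
      convert hK h00 ha0 (a := 1 - z 0 / a) (b := z 0 / a)
        (by rw [sub_nonneg, div_le_one ha]; exact x1.le) (by positivity) (by ring) using 1
      ext i; fin_cases i <;> simp [ha.ne']
    have e1 : !₂[z 0, b] ∈ K := by
      convert hK h0b hab (a := 1 - z 0 / a) (b := z 0 / a)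
        (by rw [sub_nonneg, div_le_one ha]; exact x1.le) (by positivity) (by ring) using 1
      ext i; fin_cases i <;> simp [ha.ne']; ring
    convert hK e0 e1 (a := 1 - z 1 / b) (b := z 1 / b)
      (by rw [sub_nonneg, div_le_one hb]; exact y1.le) (by positivity) (by ring) using 1
    ext i; fin_cases i <;> simp [hb.ne']; ring
  calc ENNReal.ofReal ((b * (R 0 - L 0) + a * (T 1 - D 1)) / 2)
      = volume (Q ∪ (SR ∪ (ST ∪ (SL ∪ SD)))) := by
        rw [measure_union₀ ((nm _ _ _).union ((nm _ _ _).union ((nm _ _ _).union (nm _ _ _))))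
            (by simp only [disjoint_union_right]; exact ⟨dQR, dQT, dQL, dQD⟩ : Disjoint _ _).aedisjoint,
          measure_union₀ ((nm _ _ _).union ((nm _ _ _).union (nm _ _ _)))
            (by simp only [disjoint_union_right]; exact ⟨dRT, dRL, dRD⟩ : Disjoint _ _).aedisjoint,
          measure_union₀ ((nm _ _ _).union (nm _ _ _))
            (by simp only [disjoint_union_right]; exact ⟨dTL, dTD⟩ : Disjoint _ _).aedisjoint,
          measure_union₀ (nm _ _ _) dLD.aedisjoint, volume_openRectangle ha.le, vR, vT, vL, vD,
          ← ENNReal.ofReal_add pL pD, ← ENNReal.ofReal_add pT (by positivity),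
          ← ENNReal.ofReal_add pR (by positivity), ← ENNReal.ofReal_add (by positivity) (by positivity)]
        ring_nf
    _ ≤ volume K := measure_mono (union_subset sQ
        (union_subset (openTriangle_subset hK ha0 hab hR)
        (union_subset (openTriangle_subset hK h0b hab hT)
        (union_subset (openTriangle_subset hK h00 h0b hL) (openTriangle_subset hK h00 ha0 hD)))))

/-- A convex set containing `[0, a] × [0, b]` and having horizontal extent `w` and vertical extent `h`
has area at least `(b w + a h) / 2`. -/
theorem volume_ge_of_rectangle {K : Set Plane} (hK : Convex ℝ K) {a b : ℝ} (ha : 0 < a)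
    (hb : 0 < b) (h00 : !₂[0, 0] ∈ K) (ha0 : !₂[a, 0] ∈ K) (hab : !₂[a, b] ∈ K)
    (h0b : !₂[0, b] ∈ K) {X Y Z W : Plane} (hX : X ∈ K) (hY : Y ∈ K) (hZ : Z ∈ K) (hW : W ∈ K) :
    ENNReal.ofReal ((b * (X 0 - Y 0) + a * (Z 1 - W 1)) / 2) ≤ volume K := by
  classical
  -- `K` need not be closed, so extreme points are taken in a finite subset.
  set F : Finset Plane := {!₂[0, 0], !₂[a, 0], !₂[a, b], !₂[0, b], X, Y, Z, W} with hF
  have hFK : ∀ z ∈ F, z ∈ K := by simp [*]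
  have hne : F.Nonempty := ⟨X, by simp [hF]⟩
  have hXF : X ∈ F := by simp [hF]
  have hYF : Y ∈ F := by simp [hF]
  have hZF : Z ∈ F := by simp [hF]
  have hWF : W ∈ F := by simp [hF]
  have h00F : !₂[0, 0] ∈ F := by simp [hF]
  have habF : !₂[a, b] ∈ F := by simp [hF]
  obtain ⟨R, hR, hR'⟩ := F.exists_max_image (fun z => z 0) hne
  obtain ⟨L, hL, hL'⟩ := F.exists_min_image (fun z => z 0) hne
  obtain ⟨T, hT, hT'⟩ := F.exists_max_image (fun z => z 1) hne
  obtain ⟨D, hD, hD'⟩ := F.exists_min_image (fun z => z 1) hne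
  refine le_trans (ENNReal.ofReal_le_ofReal ?_) (volume_ge_of_extreme hK ha hb h00 ha0 hab h0b
    (hFK L hL) (hFK R hR) (hFK D hD) (hFK T hT) (by simpa using hR' _ habF) (hR' D hD) (hR' T hT)
    (by simpa using hL' _ h00F) (hL' D hD) (hL' T hT)
    (by simpa using hT' _ habF) (hT' L hL) (hT' R hR)
    (by simpa using hD' _ h00F) (hD' L hL) (hD' R hR))
  have := mul_le_mul_of_nonneg_left (sub_le_sub (hR' X hXF) (hL' Y hYF)) hb.le
  have := mul_le_mul_of_nonneg_left (sub_le_sub (hT' Z hZF) (hD' W hWF)) ha.le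
  linarith

/-! ### Three unit arcs -/

theorem eVariationOn_of_dist_eq {γ : ℝ → Plane} {p q : ℝ} (hpq : p ≤ q)
    (h : ∀ s ∈ Icc p q, ∀ t ∈ Icc p q, dist (γ s) (γ t) = |s - t|) :
    eVariationOn γ (Icc p q) = ENNReal.ofReal (q - p) := by
  apply le_antisymm
  · have hl : LipschitzOnWith 1 γ (Icc p q) := by
      refine LipschitzOnWith.of_dist_le_mul fun s hs t ht => ?_
      rw [h s hs t ht, Real.dist_eq, NNReal.coe_one, one_mul]
    have h1 := hl.comp_eVariationOn_le (g := id) (s := Icc p q) (fun x hx => hx)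
    have h2 := MonotoneOn.eVariationOn_eq (f := (id : ℝ → ℝ)) (s := Icc p q) (a := p) (b := q)
      (monotone_id.monotoneOn _) (left_mem_Icc.2 hpq) (right_mem_Icc.2 hpq)
    rw [inter_self] at h2
    simpa [h2] using h1
  · have h1 := eVariationOn.edist_le γ (right_mem_Icc.2 hpq) (left_mem_Icc.2 hpq)
    rwa [edist_dist, h q (right_mem_Icc.2 hpq) p (left_mem_Icc.2 hpq),
      abs_of_nonneg (sub_nonneg.2 hpq)] at h1

theorem eVariationOn_Icc_add (γ : ℝ → Plane) {p q r : ℝ} (hpq : p ≤ q) (hqr : q ≤ r) :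
    eVariationOn γ (Icc p r) = eVariationOn γ (Icc p q) + eVariationOn γ (Icc q r) := by
  have := eVariationOn.Icc_add_Icc γ (s := univ) hpq hqr (mem_univ q)
  simpa using this.symm

theorem dist_plane_eq {x y : Plane} {r : ℝ} (hr : (x 0 - y 0) ^ 2 + (x 1 - y 1) ^ 2 = r ^ 2) :
    dist x y = |r| := by
  rw [EuclideanSpace.dist_eq, Fin.sum_univ_two, Real.dist_eq, Real.dist_eq, sq_abs, sq_abs, hr,
    Real.sqrt_sq_eq_abs]

/-- The unit segment on the horizontal axis. -/
noncomputable def segmentPath (t : ℝ) : Plane := !₂[t, 0]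

/-- The unit-speed path along two sides of an equilateral triangle of side `1/2`, from `(0, 0)` through
`(1/2, 0)` to `(1/4, √3/4)`. The lattice form makes continuity immediate. -/
noncomputable def trianglePath (t : ℝ) : Plane :=
  !₂[min t (3 / 4 - t / 2), max 0 (√3 * (t / 2 - 1 / 4))]

/-- The unit-speed path along three sides of `[0, 2/5] × [0, 3/10]`, from `(0, 3/10)` through `(0, 0)`
and `(2/5, 0)` to `(2/5, 3/10)`. -/
noncomputable def rectanglePath (t : ℝ) : Plane :=
  !₂[max 0 (min (2 / 5) (t - 3 / 10)), max (max (3 / 10 - t) (t - 7 / 10)) 0]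

theorem isUnitArc_segmentPath : IsUnitArc (segmentPath '' Icc 0 1) := by
  refine ⟨segmentPath, ?_, ?_, ?_, rfl⟩
  · unfold segmentPath
    fun_prop
  · intro s _ t _ h
    simpa [segmentPath] using congrArg (fun z : Plane => z 0) h
  · rw [eVariationOn_of_dist_eq zero_le_one]
    · simp
    · intro s _ t _
      exact dist_plane_eq (by simp [segmentPath])

theorem isUnitArc_trianglePath : IsUnitArc (trianglePath '' Icc 0 1) := by
  have h3 : √3 ^ 2 = 3 := Real.sq_sqrt (by norm_num)
  have h30 : 0 < √3 := by positivity
  have hlo : ∀ t ∈ Icc (0 : ℝ) (1 / 2), trianglePath t = !₂[t, 0] := by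
    intro t ht
    rw [trianglePath, min_eq_left (by linarith [ht.2]), max_eq_left (by nlinarith [ht.2])]
  have hhi : ∀ t ∈ Icc (1 / 2 : ℝ) 1,
      trianglePath t = !₂[3 / 4 - t / 2, √3 * (t / 2 - 1 / 4)] := by
    intro t ht
    rw [trianglePath, min_eq_right (by linarith [ht.1]), max_eq_right (by nlinarith [ht.1])]
  refine ⟨trianglePath, ?_, ?_, ?_, rfl⟩
  · unfold trianglePath
    fun_prop
  · intro s hs t ht h
    have h0 := congrArg (fun z : Plane => z 0) h
    have h1 := congrArg (fun z : Plane => z 1) h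
    rcases le_total s (1 / 2) with hs' | hs' <;> rcases le_total t (1 / 2) with ht' | ht'
    · rw [hlo s ⟨hs.1, hs'⟩, hlo t ⟨ht.1, ht'⟩] at h0
      simpa using h0
    · rw [hlo s ⟨hs.1, hs'⟩, hhi t ⟨ht', ht.2⟩] at h0 h1
      simp at h0 h1
      linarith
    · rw [hhi s ⟨hs', hs.2⟩, hlo t ⟨ht.1, ht'⟩] at h0 h1
      simp at h0 h1
      linarith
    · rw [hhi s ⟨hs', hs.2⟩, hhi t ⟨ht', ht.2⟩] at h0
      simp at h0
      linarith
  · rw [eVariationOn_Icc_add _ (q := 1 / 2) (by norm_num) (by norm_num),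
      eVariationOn_of_dist_eq (by norm_num), eVariationOn_of_dist_eq (by norm_num),
      ← ENNReal.ofReal_add (by norm_num) (by norm_num)]
    · norm_num
    · intro s hs t ht
      rw [hhi s hs, hhi t ht]
      refine dist_plane_eq ?_
      simp
      linear_combination (s - t) ^ 2 / 4 * h3
    · intro s hs t ht
      rw [hlo s hs, hlo t ht]
      exact dist_plane_eq (by simp)

theorem isUnitArc_rectanglePath : IsUnitArc (rectanglePath '' Icc 0 1) := by
  have h1 : ∀ t ∈ Icc (0 : ℝ) (3 / 10), rectanglePath t = !₂[0, 3 / 10 - t] := by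
    intro t ht
    rw [rectanglePath, min_eq_right (by linarith [ht.2]), max_eq_left (by linarith [ht.2]),
      max_eq_left (a := 3 / 10 - t) (by linarith [ht.2]), max_eq_left (by linarith [ht.2])]
  have h2 : ∀ t ∈ Icc (3 / 10 : ℝ) (7 / 10), rectanglePath t = !₂[t - 3 / 10, 0] := by
    intro t ht
    rw [rectanglePath, min_eq_right (by linarith [ht.2]), max_eq_right (by linarith [ht.1]),
      max_eq_right (max_le (by linarith [ht.1]) (by linarith [ht.2]))]
  have h3 : ∀ t ∈ Icc (7 / 10 : ℝ) 1, rectanglePath t = !₂[2 / 5, t - 7 / 10] := by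
    intro t ht
    rw [rectanglePath, min_eq_left (by linarith [ht.1]), max_eq_right (by norm_num),
      max_eq_right (a := 3 / 10 - t) (by linarith [ht.1]), max_eq_left (by linarith [ht.1])]
  refine ⟨rectanglePath, ?_, ?_, ?_, rfl⟩
  · unfold rectanglePath
    fun_prop
  · intro s hs t ht h
    have e0 := congrArg (fun z : Plane => z 0) h
    have e1 := congrArg (fun z : Plane => z 1) h
    have cases3 : ∀ r ∈ Icc (0 : ℝ) 1, r ∈ Icc (0 : ℝ) (3 / 10) ∨
        r ∈ Icc (3 / 10 : ℝ) (7 / 10) ∨ r ∈ Icc (7 / 10 : ℝ) 1 := by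
      intro r hr
      rcases le_total r (3 / 10) with h | h
      · exact Or.inl ⟨hr.1, h⟩
      rcases le_total r (7 / 10) with h' | h'
      · exact Or.inr (Or.inl ⟨h, h'⟩)
      · exact Or.inr (Or.inr ⟨h', hr.2⟩)
    rcases cases3 s hs with hs | hs | hs <;> rcases cases3 t ht with ht | ht | ht <;>
      simp only [h1 _, h2 _, h3 _, hs, ht] at e0 e1 <;> simp at e0 e1 <;>
      linarith [hs.1, hs.2, ht.1, ht.2]
  · rw [eVariationOn_Icc_add _ (q := 3 / 10) (by norm_num) (by norm_num),
      eVariationOn_Icc_add _ (p := 3 / 10) (q := 7 / 10) (by norm_num) (by norm_num),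
      eVariationOn_of_dist_eq (by norm_num), eVariationOn_of_dist_eq (by norm_num),
      eVariationOn_of_dist_eq (by norm_num),
      ← ENNReal.ofReal_add (by norm_num) (by norm_num),
      ← ENNReal.ofReal_add (by norm_num) (by norm_num)]
    · norm_num
    · intro s hs t ht
      rw [h3 s hs, h3 t ht]
      exact dist_plane_eq (by simp)
    · intro s hs t ht
      rw [h2 s hs, h2 t ht]
      exact dist_plane_eq (by simp)
    · intro s hs t ht
      rw [h1 s hs, h1 t ht]
      exact dist_plane_eq (by simp; ring)

/-! ### Extents of the segment and the triangle -/

/-- Let `(k, t)` be the cosine and sine of the angle from a unit vector `d` to a side of an equilateral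
triangle; with `m = ±√3/2`, the quantities `t`, `m k + t/2`, `m k - t/2` are the sines for the three
side directions. If none exceeds `0.91` in absolute value, one of them is at most `1/10`. -/
theorem exists_small_of_hexagon {k t m : ℝ} (hm : m ^ 2 = 3 / 4) (hkt : k ^ 2 + t ^ 2 = 1)
    (h0 : |t| < 91 / 100) (h1 : |m * k + t / 2| < 91 / 100) (h2 : |m * k - t / 2| < 91 / 100) :
    |t| ≤ 1 / 10 ∨ |m * k + t / 2| ≤ 1 / 10 ∨ |m * k - t / 2| ≤ 1 / 10 := by
  -- Of `t`, `q` and `-(t + q)`, which sum to zero, two have the same sign; their absolute values are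
  -- the `u` and `v` here.
  have aux : ∀ u v : ℝ, 1 / 10 < u → 1 / 10 < v → u + v < 91 / 100 →
      u ^ 2 + u * v + v ^ 2 = 3 / 4 → False := by
    intro u v hu hv huv h
    nlinarith [mul_pos (sub_pos.2 hu) (sub_pos.2 hv)]
  by_contra! h
  obtain ⟨g0, g1, g2⟩ := h
  set q := m * k - t / 2 with hq
  have hp : m * k + t / 2 = t + q := by rw [hq]; ring
  have hsq : t ^ 2 + t * q + q ^ 2 = 3 / 4 := by
    rw [hq]
    linear_combination k ^ 2 * hm + 3 / 4 * hkt
  rw [hp] at g1 h1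
  rw [abs_lt] at h0 h1 h2
  rcases lt_abs.1 g0 with g0 | g0 <;> rcases lt_abs.1 g1 with g1 | g1 <;>
    rcases lt_abs.1 g2 with g2 | g2
  · exact aux t q g0 g2 h1.2 hsq
  · exact aux (t + q) (-q) g1 g2 (by linarith) (by linear_combination hsq)
  · linarith
  · exact aux t (-(t + q)) g0 g1 (by linarith) (by linear_combination hsq)
  · exact aux (-t) (t + q) g0 g1 (by linarith) (by linear_combination hsq)
  · linarith
  · exact aux (-(t + q)) q g1 g2 (by linarith) (by linear_combination hsq)
  · exact aux (-t) (-q) g0 g2 (by linarith) (by linear_combination hsq)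

/-- `(c, s)` is the direction of the unit segment and `(x, y)` that of a side of the triangle at an angle
with sine at most `1/10` to it; `m x + y/2` is the vertical component of that side turned by `60°`.
Writing this component as `k (m c + s/2) + t (c/2 - m s)`, where `k` and `t` are the cosine and sine
of the angle from segment to side, and using `k ≥ 0.994`, `|t| ≤ 0.1` bounds it below by a linear
form in `c` and `s`. -/
theorem extents_ge_of_near {c s x y m : ℝ} (hc : 0 ≤ c) (hs : 0 ≤ s) (hcs : c ^ 2 + s ^ 2 = 1)
    (hxy : x ^ 2 + y ^ 2 = 1) (hm : m ^ 2 = 3 / 4) (hm0 : 0 ≤ m) (hs' : s ≤ 48 / 100)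
    (ht : |c * y - s * x| ≤ 1 / 10) :
    455 / 1000 ≤ 3 / 10 * c + 1 / 5 * |m * x + y / 2| := by
  wlog hk : 0 ≤ c * x + s * y generalizing x y
  · have := this (x := -x) (y := -y) (by linarith) (by rwa [show c * -y - s * -x = -(c * y - s * x) by ring, abs_neg])
      (by linarith)
    rwa [show m * -x + -y / 2 = -(m * x + y / 2) by ring, abs_neg] at this
  set k := c * x + s * y with hkdef
  set t := c * y - s * x with htdef
  have hkt : k ^ 2 + t ^ 2 = 1 := by
    rw [hkdef, htdef]
    linear_combination (x ^ 2 + y ^ 2) * hcs + hxy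
  have hx : m * x + y / 2 = k * (m * c + s / 2) + t * (c / 2 - m * s) := by
    rw [hkdef, htdef]
    linear_combination (-m * x - y / 2) * hcs
  have hk1 : 994 / 1000 ≤ k := by
    have := sq_le_sq' (abs_le.1 ht).1 (abs_le.1 ht).2
    nlinarith
  have hm1 : 866 / 1000 ≤ m := by nlinarith
  have hm2 : m ≤ 8661 / 10000 := by nlinarith
  -- The arc of the unit circle over `0 ≤ s ≤ 0.48` lies above its chord.
  have hc1 : 1 - 256 / 1000 * s ≤ c := by nlinarith
  have hpos : 0 ≤ c / 2 - m * s := by nlinarith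
  have e1 : 994 / 1000 * (866 / 1000 * c + s / 2) ≤ k * (m * c + s / 2) := by
    have := mul_le_mul_of_nonneg_right hm1 hc
    exact mul_le_mul hk1 (by linarith) (by positivity) hk
  have e2 : -(1 / 10 * (c / 2 - 866 / 1000 * s)) ≤ t * (c / 2 - m * s) := by
    nlinarith [mul_le_mul_of_nonneg_right (abs_le.1 ht).1 hpos, mul_le_mul_of_nonneg_right hm1 hs]
  have := le_abs_self (m * x + y / 2)
  linarith

/-- If the unit segment `(c, s)` and the triangle with unit side directions `(x, y)`,
`(x/2 - m y, m x + y/2)`, `(-x/2 - m y, m x - y/2)` satisfy the cross product bounds, then every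
`W` and `H` bounding the horizontal and vertical extents satisfy `3/10 W + 2/5 H ≥ 0.455`. Here
`W ≥ 2/5` accounts for the rectangle. -/
theorem extents_ge_of_nonneg {c s x y m W H : ℝ} (hc : 0 ≤ c) (hs : 0 ≤ s)
    (hcs : c ^ 2 + s ^ 2 = 1) (hxy : x ^ 2 + y ^ 2 = 1) (hm : m ^ 2 = 3 / 4) (hm0 : 0 ≤ m)
    (hcW : c ≤ W) (hsH : s ≤ H) (hW : 2 / 5 ≤ W)
    (hy0 : |y| / 2 ≤ H) (hy1 : |m * x + y / 2| / 2 ≤ H) (hy2 : |m * x - y / 2| / 2 ≤ H)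
    (ht0 : |c * y - s * x| < 91 / 100)
    (ht1 : |c * (m * x + y / 2) - s * (x / 2 - m * y)| < 91 / 100)
    (ht2 : |c * (m * x - y / 2) - s * (-x / 2 - m * y)| < 91 / 100) :
    455 / 1000 ≤ 3 / 10 * W + 2 / 5 * H := by
  by_contra! hlt
  have hs1 : s ≤ 48 / 100 := by
    by_contra! hs1
    -- For `s > 0.97` the extents `2/5` and `s` alone give more than `0.455`; in between,
    -- `3/10 * c + 2/5 * s` does.
    have hs2 : s ≤ 97 / 100 := by linarith
    nlinarith [mul_nonneg (sub_nonneg.2 hs1.le) (sub_nonneg.2 hs2)]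
  have f1 : c * (m * x + y / 2) - s * (x / 2 - m * y)
      = m * (c * x + s * y) + (c * y - s * x) / 2 := by ring
  have f2 : c * (m * x - y / 2) - s * (-x / 2 - m * y)
      = m * (c * x + s * y) - (c * y - s * x) / 2 := by ring
  have hrot : (x / 2 - m * y) ^ 2 + (m * x + y / 2) ^ 2 = 1 := by
    linear_combination (x ^ 2 + y ^ 2) * hm + hxy
  have hrot' : (-x / 2 - m * y) ^ 2 + (m * x - y / 2) ^ 2 = 1 := by
    linear_combination (x ^ 2 + y ^ 2) * hm + hxy
  rcases exists_small_of_hexagon (k := c * x + s * y) (t := c * y - s * x) hm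
    (by linear_combination (x ^ 2 + y ^ 2) * hcs + hxy) ht0 (f1 ▸ ht1) (f2 ▸ ht2) with h | h | h
  · linarith [extents_ge_of_near hc hs hcs hxy hm hm0 hs1 h]
  · have := extents_ge_of_near hc hs hcs hrot hm hm0 hs1 (f1 ▸ h)
    rw [show m * (x / 2 - m * y) + (m * x + y / 2) / 2 = m * x - y / 2 by
      linear_combination -y * hm] at this
    linarith
  · have := extents_ge_of_near hc hs hcs hrot' hm hm0 hs1 (f2 ▸ h)
    rw [show m * (-x / 2 - m * y) + (m * x - y / 2) / 2 = -y by
      linear_combination -y * hm, abs_neg] at this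
    linarith

/-- The case of arbitrary signs of `c`, `s`, `m`: reflections in the axes permute the sides of the
triangle up to sign. -/
theorem extents_ge {c s x y m W H : ℝ}
    (hcs : c ^ 2 + s ^ 2 = 1) (hxy : x ^ 2 + y ^ 2 = 1) (hm : m ^ 2 = 3 / 4)
    (hcW : |c| ≤ W) (hsH : |s| ≤ H) (hW : 2 / 5 ≤ W)
    (hy0 : |y| / 2 ≤ H) (hy1 : |m * x + y / 2| / 2 ≤ H) (hy2 : |m * x - y / 2| / 2 ≤ H)
    (ht0 : |c * y - s * x| < 91 / 100)
    (ht1 : |c * (m * x + y / 2) - s * (x / 2 - m * y)| < 91 / 100)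
    (ht2 : |c * (m * x - y / 2) - s * (-x / 2 - m * y)| < 91 / 100) :
    455 / 1000 ≤ 3 / 10 * W + 2 / 5 * H := by
  wlog hc : 0 ≤ c generalizing c x
  · refine this (c := -c) (x := -x) (by linarith) (by linarith) (by rwa [abs_neg]) ?_ ?_ ?_ ?_ ?_
      (by linarith)
    · rwa [show m * -x + y / 2 = -(m * x - y / 2) by ring, abs_neg]
    · rwa [show m * -x - y / 2 = -(m * x + y / 2) by ring, abs_neg]
    · rwa [show -c * y - s * -x = -(c * y - s * x) by ring, abs_neg]
    · convert ht2 using 2; ring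
    · convert ht1 using 2; ring
  wlog hs : 0 ≤ s generalizing s y
  · refine this (s := -s) (y := -y) (by rwa [abs_neg]) (by rwa [abs_neg]) (by linarith)
      (by linarith) ?_ ?_ ?_ ?_ ?_ (by linarith)
    · convert hy2 using 3; ring
    · convert hy1 using 3; ring
    · rwa [show c * -y - -s * x = -(c * y - s * x) by ring, abs_neg]
    · convert ht2 using 2; ring
    · convert ht1 using 2; ring
  rw [abs_of_nonneg hc] at hcW
  rw [abs_of_nonneg hs] at hsH
  rcases le_total 0 m with hm0 | hm0
  · exact extents_ge_of_nonneg hc hs hcs hxy hm hm0 hcW hsH hW hy0 hy1 hy2 ht0 ht1 ht2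
  · refine extents_ge_of_nonneg (m := -m) hc hs hcs hxy (by linarith) (by linarith) hcW hsH hW
      hy0 ?_ ?_ ht0 ?_ ?_
    · rwa [show -m * x + y / 2 = -(m * x - y / 2) by ring, abs_neg]
    · rwa [show -m * x - y / 2 = -(m * x + y / 2) by ring, abs_neg]
    · rw [← abs_neg]; convert ht2 using 2; ring
    · rw [← abs_neg]; convert ht1 using 2; ring

/-! ### Congruent copies in a cover -/

theorem volume_isometryEquiv_preimage (e : Plane ≃ᵢ Plane) (K : Set Plane) :
    volume (e ⁻¹' K) = volume K := by
  rw [← EuclideanSpace.euclideanHausdorffMeasure_eq_volume]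
  exact (e.measurePreserving_euclideanHausdorffMeasure 2).measure_preimage_emb
    e.toHomeomorph.measurableEmbedding K

theorem convex_isometryEquiv_preimage (e : Plane ≃ᵢ Plane) {K : Set Plane} (hK : Convex ℝ K) :
    Convex ℝ (e ⁻¹' K) :=
  hK.affine_preimage e.toRealAffineIsometryEquiv.toAffineEquiv.toAffineMap

theorem IsUnitArcCover.isometryEquiv_preimage (e : Plane ≃ᵢ Plane) {K : Set Plane}
    (hK : IsUnitArcCover K) : IsUnitArcCover (e ⁻¹' K) := by
  intro A hA
  obtain ⟨f, hf⟩ := hK A hA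
  refine ⟨f.trans e.symm, ?_⟩
  rintro _ ⟨z, hz, rfl⟩
  simpa using hf (mem_image_of_mem f hz)

theorem dist_sq_plane (x y : Plane) : dist x y ^ 2 = (x 0 - y 0) ^ 2 + (x 1 - y 1) ^ 2 := by
  rw [EuclideanSpace.dist_eq, Fin.sum_univ_two, Real.dist_eq, Real.dist_eq, sq_abs, sq_abs,
    Real.sq_sqrt (by positivity)]

theorem IsUnitArcCover.exists_segment {K : Set Plane} (hK : IsUnitArcCover K) :
    ∃ A ∈ K, ∃ B ∈ K, (B 0 - A 0) ^ 2 + (B 1 - A 1) ^ 2 = 1 := by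
  obtain ⟨e, he⟩ := hK _ isUnitArc_segmentPath
  have hmem : ∀ t ∈ Icc (0 : ℝ) 1, e (segmentPath t) ∈ K := fun t ht =>
    he (mem_image_of_mem e (mem_image_of_mem _ ht))
  refine ⟨_, hmem 0 (by simp), _, hmem 1 (by simp), ?_⟩
  rw [← dist_sq_plane, e.dist_eq, dist_sq_plane]
  simp [segmentPath]

theorem IsUnitArcCover.exists_triangle {K : Set Plane} (hK : IsUnitArcCover K) :
    ∃ C ∈ K, ∃ D ∈ K, ∃ E ∈ K, (D 0 - C 0) ^ 2 + (D 1 - C 1) ^ 2 = 1 / 4 ∧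
      (E 0 - C 0) ^ 2 + (E 1 - C 1) ^ 2 = 1 / 4 ∧ (E 0 - D 0) ^ 2 + (E 1 - D 1) ^ 2 = 1 / 4 := by
  obtain ⟨e, he⟩ := hK _ isUnitArc_trianglePath
  have hmem : ∀ t ∈ Icc (0 : ℝ) 1, e (trianglePath t) ∈ K := fun t ht =>
    he (mem_image_of_mem e (mem_image_of_mem _ ht))
  have h3 : √3 ^ 2 = 3 := Real.sq_sqrt (by norm_num)
  have h30 : 0 ≤ √3 := by positivity
  have t0 : trianglePath 0 = !₂[0, 0] := by
    rw [trianglePath, min_eq_left (by norm_num), max_eq_left (by linarith)]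
  have t1 : trianglePath (1 / 2) = !₂[1 / 2, 0] := by
    rw [trianglePath, min_eq_left (by norm_num), max_eq_left (by linarith)]
  have t2 : trianglePath 1 = !₂[1 / 4, √3 / 4] := by
    rw [trianglePath, min_eq_right (by norm_num), max_eq_right (by linarith)]
    congr 2
    · norm_num
    · congr 1
      ring
  refine ⟨_, hmem 0 (by simp), _, hmem (1 / 2) (by norm_num), _, hmem 1 (by simp), ?_, ?_, ?_⟩ <;>
    rw [← dist_sq_plane, e.dist_eq, dist_sq_plane]
  · rw [t0, t1]
    norm_num
  · rw [t0, t2]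
    simp
    linear_combination h3 / 16
  · rw [t1, t2]
    simp
    linear_combination h3 / 16

theorem IsUnitArcCover.exists_isometryEquiv_rectangle {K : Set Plane} (hK : IsUnitArcCover K) :
    ∃ e : Plane ≃ᵢ Plane, !₂[0, 0] ∈ e ⁻¹' K ∧ !₂[2 / 5, 0] ∈ e ⁻¹' K ∧
      !₂[2 / 5, 3 / 10] ∈ e ⁻¹' K ∧ !₂[0, 3 / 10] ∈ e ⁻¹' K := by
  obtain ⟨e, he⟩ := hK _ isUnitArc_rectanglePath
  have hmem : ∀ t ∈ Icc (0 : ℝ) 1, rectanglePath t ∈ e ⁻¹' K := fun t ht =>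
    he (mem_image_of_mem e (mem_image_of_mem _ ht))
  refine ⟨e, ?_, ?_, ?_, ?_⟩
  · convert hmem (3 / 10) (by norm_num) using 1
    norm_num [rectanglePath]
  · convert hmem (7 / 10) (by norm_num) using 1
    norm_num [rectanglePath]
  · convert hmem 1 (by norm_num) using 1
    norm_num [rectanglePath]
  · convert hmem 0 (by norm_num) using 1
    norm_num [rectanglePath]

/-! ### The area of a cover -/

/-- The bound for a cover in normal position, containing the vertices of `[0, 2/5] × [0, 3/10]`. -/
theorem volume_ge_of_rectangle_mem {K : Set Plane} (hK : Convex ℝ K) (hcover : IsUnitArcCover K)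
    (h00 : !₂[0, 0] ∈ K) (ha0 : !₂[2 / 5, 0] ∈ K) (hab : !₂[2 / 5, 3 / 10] ∈ K)
    (h0b : !₂[0, 3 / 10] ∈ K) : ENNReal.ofReal 0.227498 ≤ volume K := by
  by_contra! hlt
  obtain ⟨A, hA, B, hB, hAB⟩ := hcover.exists_segment
  obtain ⟨C, hC, D, hD, E, hE, hCD, hCE, hDE⟩ := hcover.exists_triangle
  have hcross : ∀ P ∈ K, ∀ Q ∈ K, |2 * cross (B - A) (Q - P)| < 91 / 100 := by
    intro P hP Q hQ
    have h := (ENNReal.ofReal_lt_ofReal_iff (by norm_num)).1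
      ((volume_convex_ge_cross hK hP hQ hA hB).trans_lt hlt)
    rw [abs_mul, abs_two]
    norm_num at h ⊢
    linarith
  have hext : ∀ X ∈ K, ∀ Y ∈ K, ∀ Z ∈ K, ∀ V ∈ K,
      3 / 10 * (X 0 - Y 0) + 2 / 5 * (Z 1 - V 1) < 455 / 1000 := by
    intro X hX Y hY Z hZ V hV
    have h := (ENNReal.ofReal_lt_ofReal_iff (by norm_num)).1
      ((volume_ge_of_rectangle hK (by norm_num) (by norm_num) h00 ha0 hab h0b hX hY hZ hV).trans_lt
        hlt)
    norm_num at h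
    linarith
  classical
  set F : Finset Plane := {!₂[0, 0], !₂[2 / 5, 0], A, B, C, D, E} with hF
  have hFK : ∀ z ∈ F, z ∈ K := by simp [*]
  have hne : F.Nonempty := ⟨A, by simp [hF]⟩
  obtain ⟨R, hR, hR'⟩ := F.exists_max_image (fun z => z 0) hne
  obtain ⟨L, hL, hL'⟩ := F.exists_min_image (fun z => z 0) hne
  obtain ⟨T, hT, hT'⟩ := F.exists_max_image (fun z => z 1) hne
  obtain ⟨S, hS, hS'⟩ := F.exists_min_image (fun z => z 1) hne
  have hW : ∀ P ∈ F, ∀ Q ∈ F, |Q 0 - P 0| ≤ R 0 - L 0 := fun P hP Q hQ =>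
    abs_le.2 ⟨by linarith [hR' P hP, hL' Q hQ], by linarith [hR' Q hQ, hL' P hP]⟩
  have hH : ∀ P ∈ F, ∀ Q ∈ F, |Q 1 - P 1| ≤ T 1 - S 1 := fun P hP Q hQ =>
    abs_le.2 ⟨by linarith [hT' P hP, hS' Q hQ], by linarith [hT' Q hQ, hS' P hP]⟩
  have hAF : A ∈ F := by simp [hF]
  have hBF : B ∈ F := by simp [hF]
  have hCF : C ∈ F := by simp [hF]
  have hDF : D ∈ F := by simp [hF]
  have hEF : E ∈ F := by simp [hF]
  have hwidth : 2 / 5 ≤ R 0 - L 0 := by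
    have := hW !₂[0, 0] (by simp [hF]) !₂[2 / 5, 0] (by simp [hF])
    simp only [Matrix.cons_val_zero] at this
    exact (le_abs_self _).trans (by simpa using this)
  -- Twice the sides `C D` and `C E` are the unit vectors `(x, y)` and `(p, q)`, and `(p, q)` is `(x, y)`
  -- turned by `±60°`: the sign of `m = ±√3/2` records the orientation of the triangle.
  set x := 2 * (D 0 - C 0) with hx
  set y := 2 * (D 1 - C 1) with hy
  set p := 2 * (E 0 - C 0) with hp
  set q := 2 * (E 1 - C 1) with hq
  set m := x * q - y * p with hm
  have hxy : x ^ 2 + y ^ 2 = 1 := by rw [hx, hy]; linear_combination 4 * hCD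
  have hpq : p ^ 2 + q ^ 2 = 1 := by rw [hp, hq]; linear_combination 4 * hCE
  have hinner : x * p + y * q = 1 / 2 := by
    rw [hx, hy, hp, hq]; linear_combination 2 * hCD + 2 * hCE - 2 * hDE
  have hm2 : m ^ 2 = 3 / 4 := by
    rw [hm]
    linear_combination (p ^ 2 + q ^ 2) * hxy + hpq - (x * p + y * q + 1 / 2) * hinner
  have hpx : x / 2 - m * y = p := by
    rw [hm]; linear_combination p * hxy - x * hinner
  have hqy : m * x + y / 2 = q := by
    rw [hm]; linear_combination q * hxy - y * hinner
  have hqy' : m * x - y / 2 = q - y := by linarith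
  have hpx' : -x / 2 - m * y = p - x := by linarith
  have half : ∀ u : ℝ, |2 * u| / 2 = |u| := fun u => by rw [abs_mul, abs_two]; ring
  refine absurd (extents_ge (c := B 0 - A 0) (s := B 1 - A 1) (W := R 0 - L 0) (H := T 1 - S 1)
    hAB hxy hm2 (hW A hAF B hBF) (hH A hAF B hBF) hwidth ?_ ?_ ?_ ?_ ?_ ?_)
    (not_le.2 (hext R (hFK R hR) L (hFK L hL) T (hFK T hT) S (hFK S hS)))
  · rw [hy, half]
    exact hH C hCF D hDF
  · rw [hqy, hq, half]
    exact hH C hCF E hEF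
  · rw [hqy', show q - y = 2 * (E 1 - D 1) by rw [hq, hy]; ring, half]
    exact hH D hDF E hEF
  · convert hcross C hC D hD using 2
    simp [cross, hx, hy]
    ring
  · rw [hqy, hpx]
    convert hcross C hC E hE using 2
    simp [cross, hp, hq]
    ring
  · rw [hqy', hpx']
    convert hcross D hD E hE using 2
    simp [cross, hp, hq, hx, hy]
    ring

theorem theorem2 (K : Set Plane) (hconv : Convex ℝ K) (hcover : IsUnitArcCover K) :
    ENNReal.ofReal 0.227498 ≤ volume K := by
  obtain ⟨e, h00, ha0, hab, h0b⟩ := hcover.exists_isometryEquiv_rectangle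
  rw [← volume_isometryEquiv_preimage e K]
  exact volume_ge_of_rectangle_mem (convex_isometryEquiv_preimage e hconv)
    (hcover.isometryEquiv_preimage e) h00 ha0 hab h0b
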